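/- Let $X\in\mathbb R^{n\times p}$, $y\in\mathbb R^n$, $\lambda,\mu\ge 0$, $k\in\mathbb Z_+$, $P=\{1,\dots,p\}$ and $Q=X^\top X+\lambda I$. Use the convention $s/0=\infty$ for $s>0$, $0/0=0$, and $0\cdot\infty=0$. For $z\in[0,1]^p$ and $\beta\in\mathbb R^p$ let $$\hat\phi(z,\beta)=\sup_{\Lambda,R}\ \beta^\top R\beta+\sum_{i=1}^p\Big(\Lambda_{ii}-\sum_{j\ne i}|\Lambda_{ij}|\Big)\frac{\beta_i^2}{z_i}+\sum_{i=1}^p\sum_{j=i+1}^p|\Lambda_{ij}|\frac{(\beta_i+\operatorname{sign}(\Lambda_{ij})\beta_j)^2}{\min\{1,z_i+z_j\}},$$ the supremum being over all $p\times p$ matrices with $\Lambda+R=Q$, $\Lambda_{ii}\ge\sum_{j<i}|\Lambda_{ji}|+\sum_{j>i}|\Lambda_{ij}|$ for all $i\in P$, and $R\succeq 0$. Consider the relaxation $$\text{(DD)}\qquad y^\top y+\inf_{\beta,z,u}\ -2y^\top X\beta+\mu\, e^\top u+\hat\phi(z,\beta)\quad\text{s.t. } e^\top z\le k,\ \beta\le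 u,\ -\beta\le u,\ \beta\in\mathbb R^p,\ z\in[0,1]^p,\ u\in\mathbb R^p_+,$$ and the conic problem ($\mathrm{SDP}_{dd}$) $$\begin{aligned} y^\top y+\inf_{\beta,z,u,w,B}\ & -2y^\top X\beta+\mu\, e^\top u+\langle Q,B\rangle\\ \text{s.t. } & e^\top z\le k,\ \ \beta\le u,\ -\beta\le u,\\ & z_iB_{ii}\ge\beta_i^2 && \forall i\in P,\\ & 0\le w_{ij}\le 1,\ w_{ij}\le z_i+z_j && \forall i\ne j,\\ & 0\ge \tfrac{(\beta_i+\beta_j)^2}{w_{ij}}-2B_{ij}-B_{ii}-B_{jj} && \forall i\ne j,\\ & 0\ge \tfrac{(\beta_i-\beta_j)^2}{w_{ij}}+2B_{ij}-B_{ii}-B_{jj} && \forall i\ne j,\\ & B-\beta\beta^\top\succeq 0,\ \ \beta\in\mathbb R^p,\ z\in[0,1]^p,\ u\in\mathbb R^p_+,\ B\in\mathbb R^{p\times p}.\end{aligned}$$ The two problems are equivalent in the following sense. 1. For every feasible $(\beta,z,u)$ of (DD) such that $\beta_i=0$ whenever $z_i=0$, the minimum of the objective of $\mathrm{SDP}_{dd}$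 over all $(w,B)$ for which $(\beta,z,u,w,B)$ is feasible is attained, and it equals the objective of (DD) at $(\beta,z,u)$. (Every feasible point of $\mathrm{SDP}_{dd}$ has $\beta_i=0$ whenever $z_i=0$.) 2. If $k\ge 1$ or $Q$ is positive definite, then (DD) and $\mathrm{SDP}_{dd}$ have the same optimal value, and $(\beta,z,u)$ can be completed to an optimal solution $(\beta,z,u,w,B)$ of $\mathrm{SDP}_{dd}$ if and only if it is an optimal solution of (DD) with $\beta_i=0$ whenever $z_i=0$. -/

import Mathlib

open Matrix

namespace SparseRegression

noncomputable section

/-- Division of a nonnegative scalar `s` by a nonnegative scalar `d`, with the convention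
`s / 0 = ∞` if `s > 0` and `0 / 0 = 0`. -/
def extDiv (s d : ℝ) : EReal :=
  if d = 0 then (if s = 0 then 0 else ⊤) else ((s / d : ℝ) : EReal)

variable {n p : ℕ}

/-- The matrix `Xᵀ X + lam I`. -/
def gram (X : Matrix (Fin n) (Fin p) ℝ) (lam : ℝ) : Matrix (Fin p) (Fin p) ℝ :=
  Xᵀ * X + lam • (1 : Matrix (Fin p) (Fin p) ℝ)

/-- The inner product `⟨A, B⟩ = ∑ i j, A i j * B i j` of two matrices. -/
def frobInner (A B : Matrix (Fin p) (Fin p) ℝ) : ℝ := ∑ i, ∑ j, A i j * B i j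

/-- `Λ + R = Q` with `Λ` diagonally dominant and `R` positive semidefinite. -/
structure IsDDDecomp (Q L R : Matrix (Fin p) (Fin p) ℝ) : Prop where
  decomp : L + R = Q
  dominant : ∀ i, (∑ j ∈ Finset.Iio i, |L j i|) + (∑ j ∈ Finset.Ioi i, |L i j|) ≤ L i i
  psd : R.PosSemidef

/-- The strengthened quadratic form of the decomposition `L + R`: the remainder `R` is kept, the
separable terms of `L` get the perspective strengthening and its pairwise rank-one terms are
divided by `min {1, z i + z j}`. In `EReal`, `0 * ⊤ = 0`, so terms with coefficient `0` vanish. -/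
def ddForm (L R : Matrix (Fin p) (Fin p) ℝ) (z β : Fin p → ℝ) : EReal :=
  ((β ⬝ᵥ R *ᵥ β : ℝ) : EReal)
    + ∑ i, ((L i i - ∑ j ∈ Finset.univ.erase i, |L i j| : ℝ) : EReal) * extDiv (β i ^ 2) (z i)
    + ∑ i, ∑ j ∈ Finset.Ioi i,
        ((|L i j| : ℝ) : EReal) *
          extDiv ((β i + Real.sign (L i j) * β j) ^ 2) (min 1 (z i + z j))

/-- The value of the best decomposition of `Q` at the point `(z, β)`. -/
def ddPhi (Q : Matrix (Fin p) (Fin p) ℝ) (z β : Fin p → ℝ) : EReal :=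
  ⨆ (L : Matrix (Fin p) (Fin p) ℝ) (R : Matrix (Fin p) (Fin p) ℝ) (_ : IsDDDecomp Q L R),
    ddForm L R z β

/-- The constraints on `(β, z, u)` common to all the relaxations. -/
structure IsBaseFeasible (k : ℕ) (β z u : Fin p → ℝ) : Prop where
  card : ∑ i, z i ≤ (k : ℝ)
  le_u : ∀ i, β i ≤ u i
  neg_le_u : ∀ i, - β i ≤ u i
  z_nonneg : ∀ i, 0 ≤ z i
  z_le_one : ∀ i, z i ≤ 1
  u_nonneg : ∀ i, 0 ≤ u i

/-- Objective of the relaxation given by the best diagonally dominant decomposition. -/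
def ddObjective (X : Matrix (Fin n) (Fin p) ℝ) (y : Fin n → ℝ) (lam mu : ℝ)
    (β z u : Fin p → ℝ) : EReal :=
  ((y ⬝ᵥ y - 2 * (y ⬝ᵥ X *ᵥ β) + mu * ∑ i, u i : ℝ) : EReal) + ddPhi (gram X lam) z β

/-- Optimal value (infimum of the objective) of the relaxation given by the best diagonally
dominant decomposition. -/
def ddValue (X : Matrix (Fin n) (Fin p) ℝ) (y : Fin n → ℝ) (lam mu : ℝ) (k : ℕ) : EReal :=
  ⨅ (β : Fin p → ℝ) (z : Fin p → ℝ) (u : Fin p → ℝ) (_ : IsBaseFeasible k β z u),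
    ddObjective X y lam mu β z u

/-- `(β, z, u)` is an optimal solution of the relaxation given by the best diagonally dominant
decomposition. -/
def IsDDOptimal (X : Matrix (Fin n) (Fin p) ℝ) (y : Fin n → ℝ) (lam mu : ℝ) (k : ℕ)
    (β z u : Fin p → ℝ) : Prop :=
  IsBaseFeasible k β z u ∧
    ∀ β' z' u' : Fin p → ℝ, IsBaseFeasible k β' z' u' →
      ddObjective X y lam mu β z u ≤ ddObjective X y lam mu β' z' u'

/-- Feasibility for the conic problem `SDP_dd`. The entries `w i i` play no role. -/
structure IsSdpFeasible (k : ℕ) (β z u : Fin p → ℝ) (w B : Matrix (Fin p) (Fin p) ℝ) :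
    Prop where
  base : IsBaseFeasible k β z u
  persp : ∀ i, β i ^ 2 ≤ z i * B i i
  w_nonneg : ∀ i j, i ≠ j → 0 ≤ w i j
  w_le_one : ∀ i j, i ≠ j → w i j ≤ 1
  w_le_add : ∀ i j, i ≠ j → w i j ≤ z i + z j
  pair_add : ∀ i j, i ≠ j →
    extDiv ((β i + β j) ^ 2) (w i j) + ((- 2 * B i j - B i i - B j j : ℝ) : EReal) ≤ 0
  pair_sub : ∀ i j, i ≠ j →
    extDiv ((β i - β j) ^ 2) (w i j) + ((2 * B i j - B i i - B j j : ℝ) : EReal) ≤ 0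
  psd : (B - vecMulVec β β).PosSemidef

/-- Objective of `SDP_dd`. -/
def sdpObjective (X : Matrix (Fin n) (Fin p) ℝ) (y : Fin n → ℝ) (lam mu : ℝ)
    (β u : Fin p → ℝ) (B : Matrix (Fin p) (Fin p) ℝ) : ℝ :=
  y ⬝ᵥ y - 2 * (y ⬝ᵥ X *ᵥ β) + mu * ∑ i, u i + frobInner (gram X lam) B

/-- Optimal value (infimum of the objective) of `SDP_dd`. -/
def sdpValue (X : Matrix (Fin n) (Fin p) ℝ) (y : Fin n → ℝ) (lam mu : ℝ) (k : ℕ) : EReal :=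
  ⨅ (β : Fin p → ℝ) (z : Fin p → ℝ) (u : Fin p → ℝ) (w : Matrix (Fin p) (Fin p) ℝ)
    (B : Matrix (Fin p) (Fin p) ℝ) (_ : IsSdpFeasible k β z u w B),
    ((sdpObjective X y lam mu β u B : ℝ) : EReal)

/-- `(β, z, u, w, B)` is an optimal solution of `SDP_dd`. -/
def IsSdpOptimal (X : Matrix (Fin n) (Fin p) ℝ) (y : Fin n → ℝ) (lam mu : ℝ) (k : ℕ)
    (β z u : Fin p → ℝ) (w B : Matrix (Fin p) (Fin p) ℝ) : Prop :=
  IsSdpFeasible k β z u w B ∧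
    ∀ (β' z' u' : Fin p → ℝ) (w' B' : Matrix (Fin p) (Fin p) ℝ),
      IsSdpFeasible k β' z' u' w' B' →
        sdpObjective X y lam mu β u B ≤ sdpObjective X y lam mu β' u' B'

end

end SparseRegression

/-!
Fix `(β, z, u)` with `β i = 0` whenever `z i = 0`. The best choice of `w` in the conic problem is
`w i j = min 1 (z i + z j)`, and with `S = B - β βᵀ` the remaining problem in `B` is a covering
semidefinite program: minimize `⟨Q, S⟩` over positive semidefinite `S` subject to lower bounds on
`vᵀ S v`, where `v` runs over the vectors `eᵢ`, `eᵢ + eⱼ` and `eᵢ - eⱼ` (`ddGen`). A dual solution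
is a nonnegative combination `L` of the matrices `v vᵀ` with `Q - L` positive semidefinite. Since these
rank-one matrices generate the diagonally dominant cone, the dual problem is the supremum that
defines `ddPhi`.

Weak duality (`ddFormReal_le_frobInner`) is the expansion of `⟨L, B⟩` into diagonal and pairwise
terms. For strong duality the primal minimum is attained even when `Q` is singular
(`exists_covering_minimizer`), and multiples of the identity are Slater points, so that Lagrange
multipliers exist (`exists_covering_multiplier`). The multipliers may put weight on both `eᵢ + eⱼ`
and `eᵢ - eⱼ`, whereas `ddForm` only sees the entry `L i j`; `exists_tight_matrix` shows that this
loses nothing, because the pairwise terms cancelled in this way are dominated by the perspective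
terms. Together these give the first part.

For the second part it remains to see that points violating the support condition do not lower the
infimum. If `Q` is positive definite, the objective is infinite there, as the decomposition
`Q = c I + (Q - c I)` shows. If `k ≥ 1`, shrinking `z` by a factor `1 / t` and adding a small
constant vector gives a feasible point of full support at which `ddPhi` grows by a factor of at most `t`,
and `t` tends to `1`.
-/

namespace SparseRegression

variable {n p : ℕ}

/-! ### The trace pairing and positive semidefinite matrices -/

theorem frobInner_eq_trace (A B : Matrix (Fin p) (Fin p) ℝ) :
    frobInner A B = (A * Bᵀ).trace := by
  simp [frobInner, Matrix.trace, Matrix.mul_apply]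

theorem frobInner_add_right (A B C : Matrix (Fin p) (Fin p) ℝ) :
    frobInner A (B + C) = frobInner A B + frobInner A C := by
  simp [frobInner_eq_trace, Matrix.mul_add]

theorem frobInner_smul_right (A B : Matrix (Fin p) (Fin p) ℝ) (c : ℝ) :
    frobInner A (c • B) = c * frobInner A B := by
  simp [frobInner_eq_trace]

theorem frobInner_add_left (A B C : Matrix (Fin p) (Fin p) ℝ) :
    frobInner (A + B) C = frobInner A C + frobInner B C := by
  simp [frobInner_eq_trace, Matrix.add_mul]

theorem frobInner_comm (A B : Matrix (Fin p) (Fin p) ℝ) : frobInner A B = frobInner B A := by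
  simp [frobInner, mul_comm]

theorem frobInner_vecMulVec (A : Matrix (Fin p) (Fin p) ℝ) (x : Fin p → ℝ) :
    frobInner A (vecMulVec x x) = x ⬝ᵥ A *ᵥ x := by
  simp only [frobInner, vecMulVec_apply, dotProduct, mulVec, Finset.mul_sum]
  exact Finset.sum_congr rfl fun i _ => Finset.sum_congr rfl fun j _ => by ring

theorem continuous_frobInner (A : Matrix (Fin p) (Fin p) ℝ) : Continuous (frobInner A) := by
  unfold frobInner
  fun_prop

theorem dotProduct_vecMulVec_mulVec (v x : Fin p → ℝ) :
    v ⬝ᵥ vecMulVec x x *ᵥ v = (v ⬝ᵥ x) ^ 2 := by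
  rw [vecMulVec_mulVec, dotProduct_smul, sq, dotProduct_comm x v]
  simp

theorem posSemidef_vecMulVec (x : Fin p → ℝ) : (vecMulVec x x).PosSemidef := by
  simpa using posSemidef_vecMulVec_self_star x

theorem posSemidef_of_quadForm {S : Matrix (Fin p) (Fin p) ℝ} (h : Sᵀ = S)
    (h' : ∀ x : Fin p → ℝ, 0 ≤ x ⬝ᵥ S *ᵥ x) : S.PosSemidef :=
  .of_dotProduct_mulVec_nonneg h (by simpa using h')

theorem quadForm_nonneg {S : Matrix (Fin p) (Fin p) ℝ} (h : S.PosSemidef) (x : Fin p → ℝ) :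
    0 ≤ x ⬝ᵥ S *ᵥ x := by
  simpa using h.dotProduct_mulVec_nonneg x

theorem transpose_eq_of_posSemidef {S : Matrix (Fin p) (Fin p) ℝ} (h : S.PosSemidef) :
    Sᵀ = S := h.1

theorem frobInner_nonneg {A B : Matrix (Fin p) (Fin p) ℝ} (hA : A.PosSemidef)
    (hB : B.PosSemidef) : 0 ≤ frobInner A B := by
  obtain ⟨m, x, rfl⟩ := Matrix.posSemidef_iff_eq_sum_vecMulVec.1 hB
  have h : frobInner A (∑ i, vecMulVec (x i) (star (x i))) = ∑ i, x i ⬝ᵥ A *ᵥ x i := by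
    simp only [star_trivial, ← frobInner_vecMulVec]
    simp [frobInner_eq_trace, transpose_sum, Matrix.mul_sum, trace_sum]
  rw [h]
  exact Finset.sum_nonneg fun i _ => quadForm_nonneg hA (x i)

theorem quadForm_single_add_smul_single (S : Matrix (Fin p) (Fin p) ℝ) (i j : Fin p) (s : ℝ) :
    (Pi.single i 1 + s • Pi.single j 1) ⬝ᵥ S *ᵥ (Pi.single i 1 + s • Pi.single j 1) =
      S i i + s * (S i j + S j i) + s ^ 2 * S j j := by
  simp only [mulVec_add, mulVec_smul, dotProduct_add, add_dotProduct, dotProduct_smul,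
    smul_dotProduct, mulVec_single_one, single_one_dotProduct, smul_eq_mul, col_apply]
  ring

theorem abs_apply_le_trace {S : Matrix (Fin p) (Fin p) ℝ} (hS : S.PosSemidef) (i j : Fin p) :
    |S i j| ≤ S.trace := by
  have hd : ∀ l, S l l ≤ S.trace := fun l =>
    Finset.single_le_sum (f := fun l => S l l) (fun m _ => hS.diag_nonneg) (Finset.mem_univ l)
  have hsym : S j i = S i j := congrFun (congrFun (transpose_eq_of_posSemidef hS) i) j
  have key : ∀ s : ℝ, 0 ≤ S i i + s * (S i j + S j i) + s ^ 2 * S j j := by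
    intro s
    have := quadForm_nonneg hS (Pi.single i 1 + s • Pi.single j 1)
    rwa [quadForm_single_add_smul_single] at this
  have h1 := key 1
  have h2 := key (-1)
  have := hd i
  have := hd j
  rw [abs_le]
  constructor <;> nlinarith

theorem isClosed_setOf_posSemidef :
    IsClosed {S : Matrix (Fin p) (Fin p) ℝ | S.PosSemidef} := by
  have : {S : Matrix (Fin p) (Fin p) ℝ | S.PosSemidef} =
      {S | Sᵀ = S} ∩ ⋂ x : Fin p → ℝ, {S | 0 ≤ x ⬝ᵥ S *ᵥ x} := by
    ext S
    simp only [Set.mem_inter_iff, Set.mem_ofPred_eq, Set.mem_iInter]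
    exact ⟨fun h => ⟨transpose_eq_of_posSemidef h, quadForm_nonneg h⟩,
      fun h => posSemidef_of_quadForm h.1 h.2⟩
  rw [this]
  refine (isClosed_eq (by fun_prop) continuous_id).inter (isClosed_iInter fun x => ?_)
  exact isClosed_le continuous_const (by fun_prop)

theorem exists_forall_lt_mul {ι : Type*} [Fintype ι] (a e : ι → ℝ) :
    ∃ r : ℝ, 0 ≤ r ∧ ∀ i, 0 < a i → e i < r * a i := by
  refine ⟨∑ i, (|e i| + 1) / |a i|, by positivity, fun i hi => ?_⟩
  have h : (|e i| + 1) / |a i| ≤ ∑ i, (|e i| + 1) / |a i| :=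
    Finset.single_le_sum (f := fun i => (|e i| + 1) / |a i|) (fun _ _ => by positivity)
      (Finset.mem_univ i)
  rw [abs_of_pos hi, div_le_iff₀ hi] at h
  linarith [le_abs_self (e i)]

/-- The orthogonal projection `P` onto the range of a positive semidefinite matrix `Q`, together
with a positive lower bound `c` for the nonzero eigenvalues of `Q`. -/
theorem exists_range_projection {Q : Matrix (Fin p) (Fin p) ℝ} (hQ : Q.PosSemidef) :
    ∃ (P : Matrix (Fin p) (Fin p) ℝ) (c : ℝ), 0 < c ∧ Pᵀ = P ∧ P * P = P ∧ P * Q = Q ∧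
      (Q - c • P).PosSemidef := by
  set d := hQ.1.eigenvalues with hd
  have hd0 : ∀ i, 0 ≤ d i := hQ.eigenvalues_nonneg
  set U : Matrix (Fin p) (Fin p) ℝ := (hQ.1.eigenvectorUnitary : Matrix (Fin p) (Fin p) ℝ)
  have hQU : Q = U * diagonal d * Uᴴ := by
    have := hQ.1.spectral_theorem
    rwa [Unitary.conjStarAlgAut_apply] at this
  have hU : Uᴴ * U = 1 := Unitary.coe_star_mul_self hQ.1.eigenvectorUnitary
  obtain ⟨c, hc, hcd⟩ : ∃ c : ℝ, 0 < c ∧ ∀ i, d i ≠ 0 → c ≤ d i := by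
    obtain ⟨r, hr, h⟩ := exists_forall_lt_mul d fun _ => 1
    refine ⟨1 / (r + 1), by positivity, fun i hi => ?_⟩
    have hpos := (hd0 i).lt_of_ne' hi
    rw [div_le_iff₀ (by positivity)]
    linarith [h i hpos]
  have hmul : ∀ a b : Fin p → ℝ, (U * diagonal a * Uᴴ) * (U * diagonal b * Uᴴ) =
      U * diagonal (fun i => a i * b i) * Uᴴ := by
    intro a b
    calc _ = U * diagonal a * (Uᴴ * U) * diagonal b * Uᴴ := by simp only [Matrix.mul_assoc]
      _ = _ := by rw [hU, Matrix.mul_one, Matrix.mul_assoc U, diagonal_mul_diagonal]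
  refine ⟨U * diagonal (fun i => if d i = 0 then 0 else 1) * Uᴴ, c, hc, ?_, ?_, ?_, ?_⟩
  · simp [Matrix.mul_assoc]
  · rw [hmul]
    congr 3
    ext i
    by_cases h : d i = 0 <;> simp [h]
  · conv_lhs => rw [hQU]
    rw [hmul, hQU]
    congr 3
    ext i
    by_cases h : d i = 0 <;> simp [h]
  · have : Q - c • (U * diagonal (fun i => if d i = 0 then 0 else 1) * Uᴴ) =
        U * diagonal (fun i => d i - c * if d i = 0 then 0 else 1) * Uᴴ := by
      conv_lhs => rw [hQU]
      rw [← Matrix.smul_mul, ← Matrix.mul_smul, ← Matrix.sub_mul, ← Matrix.mul_sub]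
      congr 2
      ext i j
      by_cases hij : i = j
      · subst hij; simp
      · simp [hij]
    rw [this]
    refine (PosSemidef.diagonal fun i => ?_).mul_mul_conjTranspose_same U
    by_cases h : d i = 0
    · simp [h]
    · simpa [h] using hcd i h

/-! ### Duality for covering semidefinite programs -/

/-- A covering semidefinite program attains its minimum, even if the cost `Q` is singular:
compressing to the range of `Q` changes neither the cost nor the constraints along vectors in that
range, the compressed matrices of bounded cost form a compact set, and the other constraints are
met at no cost by adding a large multiple of the projection onto the kernel of `Q`. -/
theorem exists_covering_minimizer {ι : Type*} [Fintype ι] {Q : Matrix (Fin p) (Fin p) ℝ}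
    (hQ : Q.PosSemidef) (v : ι → Fin p → ℝ) (hv : ∀ i, v i ≠ 0) (e : ι → ℝ) :
    ∃ S : Matrix (Fin p) (Fin p) ℝ, S.PosSemidef ∧ (∀ i, e i ≤ v i ⬝ᵥ S *ᵥ v i) ∧
      ∀ T : Matrix (Fin p) (Fin p) ℝ, T.PosSemidef → (∀ i, e i ≤ v i ⬝ᵥ T *ᵥ v i) →
        frobInner Q S ≤ frobInner Q T := by
  obtain ⟨P, c, hc, hPt, hPP, hPQ, hQP⟩ := exists_range_projection hQ
  have hQt := transpose_eq_of_posSemidef hQ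
  have hQP' : Q * P = Q := by
    have := congrArg Matrix.transpose hPQ
    rwa [transpose_mul, hPt, hQt] at this
  have hcomp_psd : ∀ T : Matrix (Fin p) (Fin p) ℝ, T.PosSemidef → (P * T * P).PosSemidef := by
    intro T hT
    have := hT.mul_mul_conjTranspose_same P
    rwa [conjTranspose_eq_transpose_of_trivial, hPt] at this
  have hcomp_cost : ∀ T : Matrix (Fin p) (Fin p) ℝ, frobInner Q (P * T * P) = frobInner Q T := by
    intro T
    rw [frobInner_eq_trace, frobInner_eq_trace, transpose_mul, transpose_mul, hPt,
      ← Matrix.mul_assoc, hQP', ← Matrix.mul_assoc, Matrix.trace_mul_comm, ← Matrix.mul_assoc, hPQ]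
  have hcomp_quad : ∀ (T : Matrix (Fin p) (Fin p) ℝ) (x : Fin p → ℝ),
      x ⬝ᵥ (P * T * P) *ᵥ x = (P *ᵥ x) ⬝ᵥ T *ᵥ (P *ᵥ x) := by
    intro T x
    rw [← mulVec_mulVec, ← mulVec_mulVec, dotProduct_mulVec, ← mulVec_transpose, hPt]
  let K : ℝ → Set (Matrix (Fin p) (Fin p) ℝ) := fun C =>
    {S | S.PosSemidef ∧ P * S * P = S ∧ frobInner Q S ≤ C ∧
      ∀ i, P *ᵥ v i = v i → e i ≤ v i ⬝ᵥ S *ᵥ v i}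
  have hKcomp : ∀ C, IsCompact (K C) := by
    intro C
    have hbox : IsCompact {S : Matrix (Fin p) (Fin p) ℝ |
        S ∈ Set.univ.pi fun _ => Set.univ.pi fun _ => Set.Icc (-(C / c)) (C / c)} :=
      isCompact_univ_pi fun _ => isCompact_univ_pi fun _ => isCompact_Icc
    refine hbox.of_isClosed_subset ?_ ?_
    · refine isClosed_setOf_posSemidef.inter (IsClosed.inter ?_ (IsClosed.inter ?_ ?_))
      · exact isClosed_eq (by fun_prop) continuous_id
      · exact isClosed_le (continuous_frobInner Q) continuous_const
      · have hset : {S : Matrix (Fin p) (Fin p) ℝ | ∀ i, P *ᵥ v i = v i → e i ≤ v i ⬝ᵥ S *ᵥ v i} =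
            ⋂ (i) (_ : P *ᵥ v i = v i), {S | e i ≤ v i ⬝ᵥ S *ᵥ v i} := by
          ext S
          simp
        have hclosed : IsClosed (⋂ (i) (_ : P *ᵥ v i = v i),
            {S : Matrix (Fin p) (Fin p) ℝ | e i ≤ v i ⬝ᵥ S *ᵥ v i}) :=
          isClosed_iInter fun i => isClosed_iInter fun _ =>
            isClosed_le continuous_const (by fun_prop)
        rw [← hset] at hclosed
        exact hclosed
    · rintro S ⟨hS, hPS, hSC, -⟩
      -- `S` lives on the range of `Q`, where `Q ≥ c`, so its trace is at most `C / c`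
      have htr : frobInner P S = S.trace := by
        rw [frobInner_eq_trace, transpose_eq_of_posSemidef hS]
        nth_rw 2 [← hPS]
        rw [Matrix.trace_mul_comm (P * S), ← Matrix.mul_assoc, hPP]
      have h0 := frobInner_nonneg hQP hS
      rw [sub_eq_add_neg, ← neg_smul, frobInner_add_left, frobInner_comm (_ • P),
        frobInner_smul_right, frobInner_comm S, htr] at h0
      have : S.trace ≤ C / c := by rw [le_div_iff₀ hc]; linarith
      exact fun i _ j _ => abs_le.1 ((abs_apply_le_trace hS i j).trans this)
  have hmem : ∀ (T : Matrix (Fin p) (Fin p) ℝ) (C : ℝ), T.PosSemidef →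
      (∀ i, e i ≤ v i ⬝ᵥ T *ᵥ v i) → frobInner Q T ≤ C → P * T * P ∈ K C := by
    intro T C hT hTe hTC
    refine ⟨hcomp_psd T hT, ?_, (hcomp_cost T).trans_le hTC, fun i hi => ?_⟩
    · calc P * (P * T * P) * P = (P * P) * T * (P * P) := by simp only [Matrix.mul_assoc]
        _ = P * T * P := by rw [hPP]
    · rw [hcomp_quad, hi]; exact hTe i
  obtain ⟨t, ht, hte⟩ := exists_forall_lt_mul (fun i => v i ⬝ᵥ v i) e
  have hT0 : (t • (1 : Matrix (Fin p) (Fin p) ℝ)).PosSemidef := PosSemidef.one.smul ht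
  have hT0e : ∀ i, e i ≤ v i ⬝ᵥ (t • (1 : Matrix (Fin p) (Fin p) ℝ)) *ᵥ v i := by
    intro i
    have hpos : 0 < v i ⬝ᵥ v i := by simpa using dotProduct_star_self_pos_iff.2 (hv i)
    simpa [smul_mulVec] using (hte i hpos).le
  obtain ⟨S, hSK, hSmin⟩ := (hKcomp (frobInner Q (t • 1))).exists_isMinOn
    ⟨_, hmem _ _ hT0 hT0e le_rfl⟩ (continuous_frobInner Q).continuousOn
  obtain ⟨hS, hPS, hSC, hSe⟩ := hSK
  have hquadK : ∀ x : Fin p → ℝ, x ⬝ᵥ (1 - P) *ᵥ x = (x - P *ᵥ x) ⬝ᵥ (x - P *ᵥ x) := by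
    intro x
    have h1 : (P *ᵥ x) ⬝ᵥ (P *ᵥ x) = x ⬝ᵥ P *ᵥ x := by
      have := hcomp_quad 1 x
      rw [Matrix.mul_one, hPP, one_mulVec] at this
      exact this.symm
    simp only [sub_mulVec, one_mulVec, dotProduct_sub, sub_dotProduct, h1,
      dotProduct_comm (P *ᵥ x) x]
    ring
  obtain ⟨r, hr, hre⟩ := exists_forall_lt_mul (fun i => v i ⬝ᵥ (1 - P) *ᵥ v i) e
  have hker : (1 - P).PosSemidef := by
    refine posSemidef_of_quadForm (by simp [hPt]) fun x => ?_
    rw [hquadK]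
    simpa using dotProduct_star_self_nonneg (x - P *ᵥ x)
  refine ⟨S + r • (1 - P), hS.add (hker.smul hr), fun i => ?_, fun T hT hTe => ?_⟩
  · rw [add_mulVec, dotProduct_add, smul_mulVec, dotProduct_smul, smul_eq_mul]
    by_cases hi : P *ᵥ v i = v i
    · exact (hSe i hi).trans (le_add_of_nonneg_right (mul_nonneg hr (quadForm_nonneg hker _)))
    · have hpos : 0 < v i ⬝ᵥ (1 - P) *ᵥ v i := by
        rw [hquadK]
        simpa using dotProduct_star_self_pos_iff.2 (sub_ne_zero.2 (Ne.symm hi))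
      exact (hre i hpos).le.trans (le_add_of_nonneg_left (quadForm_nonneg hS _))
  · have hcost : frobInner Q (S + r • (1 - P)) = frobInner Q S := by
      rw [frobInner_add_right, frobInner_smul_right, frobInner_eq_trace Q (1 - P)]
      simp [hPt, Matrix.mul_sub, hQP']
    rw [hcost]
    by_cases hTC : frobInner Q T ≤ frobInner Q (t • 1)
    · rw [← hcomp_cost T]
      exact hSmin (hmem T _ hT hTe hTC)
    · exact hSC.trans (not_le.1 hTC).le

/-- Lagrange multipliers for a covering semidefinite program, from separating the point
`(m, 0)` from the open convex set of pairs `(t, s)` that some positive semidefinite `S` achieves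
with strict slack. Multiples of the identity are Slater points. -/
theorem exists_covering_multiplier {ι : Type*} [Fintype ι] {Q : Matrix (Fin p) (Fin p) ℝ}
    (hQ : Q.PosSemidef) (v : ι → Fin p → ℝ) (hv : ∀ i, v i ≠ 0) (e : ι → ℝ) (m : ℝ)
    (hm : ∀ T : Matrix (Fin p) (Fin p) ℝ, T.PosSemidef → (∀ i, e i ≤ v i ⬝ᵥ T *ᵥ v i) →
      m ≤ frobInner Q T) :
    ∃ l : ι → ℝ, (∀ i, 0 ≤ l i) ∧ m ≤ ∑ i, l i * e i ∧
      (Q - ∑ i, l i • vecMulVec (v i) (v i)).PosSemidef := by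
  classical
  let C : Set (ℝ × (ι → ℝ)) := {q | ∃ S : Matrix (Fin p) (Fin p) ℝ, S.PosSemidef ∧
    frobInner Q S < q.1 ∧ ∀ i, q.2 i < v i ⬝ᵥ S *ᵥ v i - e i}
  have hCconv : Convex ℝ C := by
    rintro q ⟨S, hS, hS1, hS2⟩ q' ⟨S', hS', hS1', hS2'⟩ a b ha hb hab
    refine ⟨a • S + b • S', (hS.smul ha).add (hS'.smul hb), ?_, fun i => ?_⟩
    · rw [frobInner_add_right, frobInner_smul_right, frobInner_smul_right]
      simp only [Prod.fst_add, Prod.smul_fst, smul_eq_mul]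
      rcases ha.eq_or_lt with rfl | ha
      · obtain rfl : b = 1 := by linarith
        linarith
      · nlinarith [mul_lt_mul_of_pos_left hS1 ha, mul_le_mul_of_nonneg_left hS1'.le hb]
    · have h1 := hS2 i
      have h2 := hS2' i
      simp only [Prod.snd_add, Prod.smul_snd, Pi.add_apply, Pi.smul_apply, smul_eq_mul,
        add_mulVec, smul_mulVec, dotProduct_add, dotProduct_smul]
      have he : e i = a * e i + b * e i := by rw [← add_mul, hab, one_mul]
      rcases ha.eq_or_lt with rfl | ha
      · obtain rfl : b = 1 := by linarith
        linarith
      · nlinarith [mul_lt_mul_of_pos_left h1 ha, mul_le_mul_of_nonneg_left h2.le hb]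
  have hCopen : IsOpen C := by
    have : C = ⋃ (S : Matrix (Fin p) (Fin p) ℝ) (_ : S.PosSemidef),
        {q : ℝ × (ι → ℝ) | frobInner Q S < q.1} ∩
          ⋂ i, {q : ℝ × (ι → ℝ) | q.2 i < v i ⬝ᵥ S *ᵥ v i - e i} := by
      ext q
      simp only [C, Set.mem_ofPred_eq, Set.mem_iUnion, Set.mem_inter_iff, Set.mem_iInter,
        exists_prop]
    rw [this]
    refine isOpen_iUnion fun S => isOpen_iUnion fun _ => IsOpen.inter ?_ ?_
    · exact isOpen_lt continuous_const continuous_fst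
    · exact isOpen_iInter_of_finite fun i => isOpen_lt (by fun_prop) continuous_const
  have hnot : ((m, 0) : ℝ × (ι → ℝ)) ∉ C := by
    rintro ⟨S, hS, hS1, hS2⟩
    exact (hm S hS fun i => (sub_pos.1 (hS2 i)).le).not_gt hS1
  obtain ⟨f, hf⟩ := geometric_hahn_banach_open_point hCconv hCopen hnot
  set a := f (1, 0) with ha_def
  set b : ι → ℝ := fun i => f (0, Pi.single i 1) with hb_def
  have hfab : ∀ (t : ℝ) (s : ι → ℝ), f (t, s) = t * a + ∑ i, s i * b i := by
    intro t s
    have h1 : ((t, s) : ℝ × (ι → ℝ)) =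
        t • (1, 0) + ∑ i, s i • ((0, Pi.single i 1) : ℝ × (ι → ℝ)) := by
      ext j
      · simp [Prod.fst_sum]
      · simp [Prod.snd_sum, Finset.sum_apply, Pi.single_apply]
    rw [h1, map_add, map_smul, map_sum]
    simp only [map_smul, smul_eq_mul, ha_def, hb_def]
  -- each `S` contributes an open orthant to `C`; `t` and `s` measure the distance to its corner
  have hsep : ∀ (S : Matrix (Fin p) (Fin p) ℝ), S.PosSemidef → ∀ (t : ℝ) (s : ι → ℝ), 0 < t →
      (∀ i, 0 < s i) → (frobInner Q S + t) * a +
        ∑ i, (v i ⬝ᵥ S *ᵥ v i - e i - s i) * b i < m * a := by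
    intro S hS t s ht hs
    have := hf (frobInner Q S + t, fun i => v i ⬝ᵥ S *ᵥ v i - e i - s i)
      ⟨S, hS, by simpa using ht, fun i => by simpa using hs i⟩
    simpa [hfab] using this
  -- an affine function bounded above on a ray has nonpositive slope
  have hray : ∀ x y : ℝ, (∀ r : ℝ, 0 < r → r * x < y) → x ≤ 0 := by
    intro x y h
    by_contra! hx
    have := h ((|y| + 1) / x) (by positivity)
    rw [div_mul_cancel₀ _ hx.ne'] at this
    linarith [le_abs_self y]
  have ha : a ≤ 0 := by
    refine hray a (m * a - ∑ i, (- e i - 1) * b i) fun r hr => ?_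
    have := hsep 0 PosSemidef.zero r (fun _ => 1) hr fun _ => one_pos
    have h0 : frobInner Q 0 = 0 := by simp [frobInner]
    simp only [h0, zero_add, zero_mulVec, dotProduct_zero, zero_sub] at this
    linarith
  have hb : ∀ i, 0 ≤ b i := by
    intro i
    have h := hray (- b i) (m * a - a - ∑ j, (- e j - 1) * b j) fun r hr => ?_
    · linarith
    have := hsep 0 PosSemidef.zero 1 (fun j => 1 + if j = i then r else 0) one_pos
      fun j => by split_ifs <;> linarith
    have h0 : frobInner Q 0 = 0 := by simp [frobInner]
    simp only [h0, zero_add, zero_mulVec, dotProduct_zero, zero_sub, ← sub_sub] at this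
    simp only [sub_mul _ (ite _ _ _), Finset.sum_sub_distrib, ite_mul, zero_mul,
      Finset.sum_ite_eq', Finset.mem_univ, if_true] at this
    simp only [sub_mul, Finset.sum_sub_distrib] at this ⊢
    linarith
  have ha' : a < 0 := by
    refine lt_of_le_of_ne ha fun ha0 => ?_
    obtain ⟨t, ht, hte⟩ := exists_forall_lt_mul (fun i => v i ⬝ᵥ v i) e
    have := hf (frobInner Q (t • 1) + 1, 0) ⟨t • 1, PosSemidef.one.smul ht, by simp, fun i => by
      have hpos : 0 < v i ⬝ᵥ v i := by simpa using dotProduct_star_self_pos_iff.2 (hv i)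
      simpa [smul_mulVec] using hte i hpos⟩
    simp [hfab, ha0] at this
  -- letting the slack tend to zero, at a rate for which the error term is exactly `ε`
  have hlim : ∀ S : Matrix (Fin p) (Fin p) ℝ, S.PosSemidef →
      frobInner Q S * a + ∑ i, (v i ⬝ᵥ S *ᵥ v i - e i) * b i ≤ m * a := by
    intro S hS
    refine le_of_forall_pos_lt_add fun ε hε => ?_
    set D := ∑ i, b i - a with hD
    have hDpos : 0 < D := by
      have := Finset.sum_nonneg fun i (_ : i ∈ Finset.univ) => hb i
      linarith
    have := hsep S hS (ε / D) (fun _ => ε / D) (by positivity) fun _ => by positivity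
    simp only [sub_mul _ (ε / D), Finset.sum_sub_distrib, ← Finset.mul_sum] at this
    have h2 : ε / D * ∑ i, b i - ε / D * a = ε := by
      rw [← mul_sub, ← hD, div_mul_cancel₀ _ hDpos.ne']
    linarith
  refine ⟨fun i => b i / -a, fun i => div_nonneg (hb i) (by linarith), ?_, ?_⟩
  · have := hlim 0 PosSemidef.zero
    have h0 : frobInner Q 0 = 0 := by simp [frobInner]
    simp only [h0, zero_mul, zero_add, zero_mulVec, dotProduct_zero, zero_sub, neg_mul,
      Finset.sum_neg_distrib] at this
    have h1 : ∑ i, b i / -a * e i = (∑ i, e i * b i) / -a := by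
      rw [Finset.sum_div]
      exact Finset.sum_congr rfl fun i _ => by ring
    rw [h1, le_div_iff₀ (by linarith)]
    linarith
  · refine posSemidef_of_quadForm ?_ fun x => ?_
    · rw [transpose_sub, transpose_eq_of_posSemidef hQ, transpose_sum]
      simp [transpose_vecMulVec]
    · have h := hray (-a * -(x ⬝ᵥ Q *ᵥ x) + ∑ i, (v i ⬝ᵥ x) ^ 2 * b i)
        (m * a + ∑ i, e i * b i + 1) fun r hr => ?_
      · have h1 : x ⬝ᵥ (∑ i, (b i / -a) • vecMulVec (v i) (v i)) *ᵥ x =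
            (∑ i, (v i ⬝ᵥ x) ^ 2 * b i) / -a := by
          rw [sum_mulVec, dotProduct_sum, Finset.sum_div]
          refine Finset.sum_congr rfl fun i _ => ?_
          rw [smul_mulVec, dotProduct_smul, dotProduct_vecMulVec_mulVec, dotProduct_comm x]
          simp only [smul_eq_mul]
          ring
        rw [sub_mulVec, dotProduct_sub, h1, sub_nonneg, div_le_iff₀ (by linarith)]
        linarith
      · have := hlim _ ((posSemidef_vecMulVec x).smul hr.le)
        simp only [frobInner_smul_right, frobInner_vecMulVec, smul_mulVec, dotProduct_smul,
          dotProduct_vecMulVec_mulVec, smul_eq_mul, sub_mul, Finset.sum_sub_distrib, mul_assoc,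
          ← Finset.mul_sum] at this
        linarith

/-! ### Diagonally dominant matrices -/

theorem sum_Iio_add_sum_Ioi (f : Fin p → ℝ) (i : Fin p) :
    ∑ j ∈ Finset.Iio i, f j + ∑ j ∈ Finset.Ioi i, f j = ∑ j ∈ Finset.univ.erase i, f j := by
  rw [← Finset.sum_union]
  · congr 1
    ext j
    simp [lt_or_lt_iff_ne]
  · exact Finset.disjoint_left.2 fun j h1 h2 =>
      lt_asymm (Finset.mem_Iio.1 h1) (Finset.mem_Ioi.1 h2)

theorem sum_erase_eq_sum_Ioi (f : Fin p → Fin p → ℝ) :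
    ∑ i, ∑ j ∈ Finset.univ.erase i, f i j = ∑ i, ∑ j ∈ Finset.Ioi i, (f i j + f j i) := by
  simp only [← sum_Iio_add_sum_Ioi, Finset.sum_add_distrib]
  rw [add_comm]
  congr 1
  exact Finset.sum_comm' (by simp)

theorem frobInner_eq_sum_diag_add_sum_pair {L B : Matrix (Fin p) (Fin p) ℝ} (hL : Lᵀ = L)
    (hB : Bᵀ = B) :
    frobInner L B = ∑ i, (L i i - ∑ j ∈ Finset.univ.erase i, |L i j|) * B i i +
      ∑ i, ∑ j ∈ Finset.Ioi i,
        |L i j| * (B i i + B j j + 2 * (Real.sign (L i j) * B i j)) := by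
  have hLs : ∀ i j, L j i = L i j := fun i j => congrFun (congrFun hL i) j
  have hBs : ∀ i j, B j i = B i j := fun i j => congrFun (congrFun hB i) j
  have h1 : frobInner L B = ∑ i, L i i * B i i +
      ∑ i, ∑ j ∈ Finset.univ.erase i, L i j * B i j := by
    rw [frobInner, ← Finset.sum_add_distrib]
    exact Finset.sum_congr rfl fun i _ => (Finset.add_sum_erase _ _ (Finset.mem_univ i)).symm
  simp only [sub_mul, Finset.sum_sub_distrib, Finset.sum_mul]
  rw [h1, sum_erase_eq_sum_Ioi, sum_erase_eq_sum_Ioi, sub_add, ← Finset.sum_sub_distrib,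
    sub_eq_add_neg, ← Finset.sum_neg_distrib]
  congr 1
  refine Finset.sum_congr rfl fun i _ => ?_
  rw [← Finset.sum_sub_distrib, ← Finset.sum_neg_distrib]
  refine Finset.sum_congr rfl fun j _ => ?_
  have hs : |L i j| * Real.sign (L i j) = L i j := by
    rcases lt_trichotomy (L i j) 0 with h | h | h
    · simp [Real.sign_of_neg h, abs_of_neg h]
    · simp [h]
    · simp [Real.sign_of_pos h, abs_of_pos h]
  rw [hLs i j, hBs i j]
  linear_combination (-2 * B i j) * hs

theorem IsDDDecomp.transpose_eq {Q L R : Matrix (Fin p) (Fin p) ℝ} (h : IsDDDecomp Q L R)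
    (hQ : Qᵀ = Q) : Lᵀ = L := by
  have hL : L = Q - R := eq_sub_of_add_eq h.decomp
  rw [hL, transpose_sub, hQ, transpose_eq_of_posSemidef h.psd]

theorem sum_erase_abs_le_iff {L : Matrix (Fin p) (Fin p) ℝ} (hL : Lᵀ = L) (i : Fin p) :
    ∑ j ∈ Finset.Iio i, |L j i| + ∑ j ∈ Finset.Ioi i, |L i j| ≤ L i i ↔
      ∑ j ∈ Finset.univ.erase i, |L i j| ≤ L i i := by
  have hLs : ∀ j, L j i = L i j := fun j => congrFun (congrFun hL i) j
  simp only [hLs, sum_Iio_add_sum_Ioi (fun j => |L i j|)]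

/-- The generators of the cone of diagonally dominant matrices are the rank-one matrices of these
vectors: `eᵢ + eⱼ` and `eᵢ - eⱼ` for `i ≠ j`, and `eᵢ`, stored at the diagonal indices. -/
def ddGen (q : Fin p × Fin p × Bool) : Fin p → ℝ :=
  if q.1 = q.2.1 then Pi.single q.1 1
  else Pi.single q.1 1 + (if q.2.2 then (1 : ℝ) else -1) • Pi.single q.2.1 1

/-- The denominator that strengthens the square of the linear form `ddGen q`. -/
noncomputable def ddDen (z : Fin p → ℝ) (q : Fin p × Fin p × Bool) : ℝ :=
  if q.1 = q.2.1 then z q.1 else min 1 (z q.1 + z q.2.1)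

theorem ddGen_ne_zero (q : Fin p × Fin p × Bool) : ddGen q ≠ 0 := by
  intro h
  have h1 := congrFun h q.1
  unfold ddGen at h1
  split_ifs at h1 with h2 h3 <;> simp_all

theorem abs_ddGen_mul_sum_le (q : Fin p × Fin p × Bool) (i : Fin p) :
    |ddGen q i| * ∑ j ∈ Finset.univ.erase i, |ddGen q j| ≤ ddGen q i * ddGen q i := by
  have hsum : ∑ j, |ddGen q j| ≤ 2 := by
    unfold ddGen
    split_ifs with h1 h2
    · simp [Pi.single_apply, apply_ite]
    all_goals
      refine (Finset.sum_le_sum fun j _ => abs_add_le _ _).trans ?_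
      rw [Finset.sum_add_distrib]
      simp [Pi.single_apply, apply_ite, one_add_one_eq_two]
  have hval : |ddGen q i| = 0 ∨ |ddGen q i| = 1 := by
    unfold ddGen
    split_ifs with h1 h2
    · by_cases h : i = q.1 <;> simp [h]
    all_goals
      by_cases h : i = q.1
      · subst h; simp [h1]
      · by_cases h' : i = q.2.1 <;> simp [h, h', Ne.symm h1]
  rw [← abs_mul_abs_self (ddGen q i)]
  rcases hval with h | h
  · simp [h]
  · have := Finset.add_sum_erase Finset.univ (fun j => |ddGen q j|) (Finset.mem_univ i)
    simp only [h] at this ⊢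
    linarith

theorem frobInner_sum_ddGen (l : Fin p × Fin p × Bool → ℝ) (B : Matrix (Fin p) (Fin p) ℝ) :
    frobInner (∑ q, l q • vecMulVec (ddGen q) (ddGen q)) B =
      ∑ q, l q * (ddGen q ⬝ᵥ B *ᵥ ddGen q) := by
  simp only [← frobInner_vecMulVec, ← frobInner_smul_right]
  rw [frobInner_comm]
  simp [frobInner_eq_trace, transpose_sum, Matrix.mul_sum, trace_sum]

theorem isDDDecomp_sum_ddGen {Q : Matrix (Fin p) (Fin p) ℝ} {l : Fin p × Fin p × Bool → ℝ}
    (hl : ∀ q, 0 ≤ l q)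
    (hR : (Q - ∑ q, l q • vecMulVec (ddGen q) (ddGen q)).PosSemidef) :
    IsDDDecomp Q (∑ q, l q • vecMulVec (ddGen q) (ddGen q))
      (Q - ∑ q, l q • vecMulVec (ddGen q) (ddGen q)) := by
  refine ⟨by abel, fun i => ?_, hR⟩
  rw [sum_erase_abs_le_iff (by simp [transpose_sum, transpose_vecMulVec])]
  simp only [Matrix.sum_apply, Matrix.smul_apply, vecMulVec_apply, smul_eq_mul]
  refine (Finset.sum_le_sum fun j _ => Finset.abs_sum_le_sum_abs _ _).trans ?_
  rw [Finset.sum_comm]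
  refine Finset.sum_le_sum fun q _ => ?_
  simp only [abs_mul, abs_of_nonneg (hl q), ← Finset.mul_sum]
  exact mul_le_mul_of_nonneg_left (abs_ddGen_mul_sum_le q i) (hl q)

/-! ### The strengthened quadratic form on the support -/

/-- `ddForm` with real division. The two agree under the support condition, where a zero denominator
only occurs below a zero numerator and both conventions give `0 / 0 = 0`. -/
noncomputable def ddFormReal (L R : Matrix (Fin p) (Fin p) ℝ) (z β : Fin p → ℝ) : ℝ :=
  β ⬝ᵥ R *ᵥ β + ∑ i, (L i i - ∑ j ∈ Finset.univ.erase i, |L i j|) * (β i ^ 2 / z i) +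
    ∑ i, ∑ j ∈ Finset.Ioi i,
      |L i j| * ((β i + Real.sign (L i j) * β j) ^ 2 / min 1 (z i + z j))

theorem extDiv_eq_coe {s d : ℝ} (h : d = 0 → s = 0) : extDiv s d = ((s / d : ℝ) : EReal) := by
  unfold extDiv
  split_ifs with h1 h2
  · simp [h2]
  · exact absurd (h h1) h2
  · rfl

theorem extDiv_nonneg {s d : ℝ} (hs : 0 ≤ s) (hd : 0 ≤ d) : 0 ≤ extDiv s d := by
  unfold extDiv
  split_ifs
  · exact le_rfl
  · exact le_top
  · exact_mod_cast div_nonneg hs hd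

theorem eq_zero_of_min_add_eq_zero {z : Fin p → ℝ} (hz : ∀ i, 0 ≤ z i) {i j : Fin p}
    (h : min 1 (z i + z j) = 0) : z i = 0 ∧ z j = 0 := by
  have h1 : z i + z j = 0 := by
    rcases min_choice 1 (z i + z j) with h' | h' <;> linarith
  constructor <;> linarith [hz i, hz j]

theorem ereal_coe_sum {ι : Type*} (s : Finset ι) (f : ι → ℝ) :
    ((∑ i ∈ s, f i : ℝ) : EReal) = ∑ i ∈ s, (f i : EReal) := by
  classical
  induction s using Finset.induction_on with
  | empty => simp
  | insert a s ha ih => rw [Finset.sum_insert ha, Finset.sum_insert ha, EReal.coe_add, ih]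

theorem ddForm_eq_coe (L R : Matrix (Fin p) (Fin p) ℝ) {z β : Fin p → ℝ} (hz : ∀ i, 0 ≤ z i)
    (hs : ∀ i, z i = 0 → β i = 0) : ddForm L R z β = (ddFormReal L R z β : EReal) := by
  have h1 : ∀ i, extDiv (β i ^ 2) (z i) = ((β i ^ 2 / z i : ℝ) : EReal) := fun i =>
    extDiv_eq_coe fun h => by simp [hs i h]
  have h2 : ∀ i j (s : ℝ), extDiv ((β i + s * β j) ^ 2) (min 1 (z i + z j)) =
      (((β i + s * β j) ^ 2 / min 1 (z i + z j) : ℝ) : EReal) := fun i j s =>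
    extDiv_eq_coe fun h => by
      obtain ⟨hi, hj⟩ := eq_zero_of_min_add_eq_zero hz h
      simp [hs i hi, hs j hj]
  simp only [ddForm, ddFormReal, h1, h2, EReal.coe_add, ereal_coe_sum, EReal.coe_mul]

theorem ddFormReal_le_frobInner {Q L R B : Matrix (Fin p) (Fin p) ℝ} {z β : Fin p → ℝ}
    (hQ : Qᵀ = Q) (h : IsDDDecomp Q L R) (hB : (B - vecMulVec β β).PosSemidef)
    (hdiag : ∀ i, β i ^ 2 / z i ≤ B i i)
    (hadd : ∀ i j, i ≠ j → (β i + β j) ^ 2 / min 1 (z i + z j) ≤ B i i + B j j + 2 * B i j)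
    (hsub : ∀ i j, i ≠ j → (β i - β j) ^ 2 / min 1 (z i + z j) ≤ B i i + B j j - 2 * B i j) :
    ddFormReal L R z β ≤ frobInner Q B := by
  have hL := h.transpose_eq hQ
  have hBt : Bᵀ = B := by
    have := transpose_eq_of_posSemidef hB
    rwa [transpose_sub, transpose_vecMulVec, sub_left_inj] at this
  have hR : β ⬝ᵥ R *ᵥ β ≤ frobInner R B := by
    have := frobInner_nonneg h.psd hB
    rw [sub_eq_add_neg, frobInner_add_right, ← neg_one_smul ℝ, frobInner_smul_right,
      frobInner_vecMulVec] at this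
    linarith
  rw [← h.decomp, frobInner_add_left, frobInner_eq_sum_diag_add_sum_pair hL hBt, ddFormReal,
    add_comm _ (frobInner R B), ← add_assoc]
  refine add_le_add (add_le_add hR (Finset.sum_le_sum fun i _ => ?_))
    (Finset.sum_le_sum fun i _ => Finset.sum_le_sum fun j hj => ?_)
  · exact mul_le_mul_of_nonneg_left (hdiag i)
      (sub_nonneg.2 ((sum_erase_abs_le_iff hL i).1 (h.dominant i)))
  · have hij : i ≠ j := (Finset.mem_Ioi.1 hj).ne
    rcases lt_trichotomy (L i j) 0 with h0 | h0 | h0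
    · refine mul_le_mul_of_nonneg_left ?_ (abs_nonneg _)
      have := hsub i j hij
      simp only [Real.sign_of_neg h0, neg_one_mul, ← sub_eq_add_neg]
      linarith
    · simp [h0]
    · refine mul_le_mul_of_nonneg_left ?_ (abs_nonneg _)
      have := hadd i j hij
      simp only [Real.sign_of_pos h0, one_mul]
      linarith

/-- If the diagonal entries are the perspective values and the constraint along one of `eᵢ + eⱼ` and
`eᵢ - eⱼ` is tight, the other one holds. This is the form in which `z i, z j ≤ min 1 (z i + z j)`
is used. -/
theorem div_min_add_div_min_le {z β : Fin p → ℝ} (hz : ∀ i, 0 ≤ z i) (hz1 : ∀ i, z i ≤ 1)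
    (hs : ∀ i, z i = 0 → β i = 0) (i j : Fin p) :
    (β i + β j) ^ 2 / min 1 (z i + z j) + (β i - β j) ^ 2 / min 1 (z i + z j) ≤
      2 * (β i ^ 2 / z i + β j ^ 2 / z j) := by
  have key : ∀ l, z l ≤ min 1 (z i + z j) → β l ^ 2 / min 1 (z i + z j) ≤ β l ^ 2 / z l := by
    intro l hl
    rcases (hz l).eq_or_lt with h | h
    · simp [hs l h.symm]
    · exact div_le_div_of_nonneg_left (sq_nonneg _) h hl
  have h1 := key i (le_min (hz1 i) (by linarith [hz j]))
  have h2 := key j (le_min (hz1 j) (by linarith [hz i]))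
  have h3 : (β i + β j) ^ 2 / min 1 (z i + z j) + (β i - β j) ^ 2 / min 1 (z i + z j) =
      2 * (β i ^ 2 / min 1 (z i + z j) + β j ^ 2 / min 1 (z i + z j)) := by ring
  linarith

/-- A conic combination of the generators may use both `eᵢ + eⱼ` and `eᵢ - eⱼ`, while `ddForm`
reads off a single sign from the entry `L i j`. Nothing is lost: some symmetric matrix makes the
constraints that occur in `ddForm` tight and satisfies all the others. -/
theorem exists_tight_matrix {L : Matrix (Fin p) (Fin p) ℝ} (hL : Lᵀ = L) (R) {z β : Fin p → ℝ}
    (hz : ∀ i, 0 ≤ z i) (hz1 : ∀ i, z i ≤ 1) (hs : ∀ i, z i = 0 → β i = 0) :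
    ∃ B : Matrix (Fin p) (Fin p) ℝ, ddFormReal L R z β = β ⬝ᵥ R *ᵥ β + frobInner L B ∧
      ∀ q, (ddGen q ⬝ᵥ β) ^ 2 / ddDen z q ≤ ddGen q ⬝ᵥ B *ᵥ ddGen q := by
  have hLs : ∀ i j, L j i = L i j := fun i j => congrFun (congrFun hL i) j
  let b : Fin p → ℝ := fun i => β i ^ 2 / z i
  let B : Matrix (Fin p) (Fin p) ℝ := of fun i j =>
    if i = j then b i
    else if 0 ≤ L i j then ((β i + β j) ^ 2 / min 1 (z i + z j) - b i - b j) / 2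
    else (b i + b j - (β i - β j) ^ 2 / min 1 (z i + z j)) / 2
  have hBdiag : ∀ i, B i i = b i := fun i => by simp [B]
  have hBt : ∀ i j, B j i = B i j := by
    intro i j
    simp only [B, of_apply, hLs i j, eq_comm (a := j), add_comm (z j), add_comm (β j)]
    split_ifs with h1 h2
    · rw [h1]
    · ring
    · ring
  refine ⟨B, ?_, ?_⟩
  · rw [frobInner_eq_sum_diag_add_sum_pair hL (by ext i j; exact hBt i j), ddFormReal, add_assoc]
    simp only [hBdiag, b]
    congr 2
    refine Finset.sum_congr rfl fun i _ => Finset.sum_congr rfl fun j hj => ?_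
    have hij : i ≠ j := (Finset.mem_Ioi.1 hj).ne
    rcases lt_trichotomy (L i j) 0 with h0 | h0 | h0
    · simp only [B, of_apply, if_neg hij, if_neg h0.not_ge, Real.sign_of_neg h0, b]
      ring
    · simp [h0]
    · simp only [B, of_apply, if_neg hij, if_pos h0.le, Real.sign_of_pos h0, b]
      ring
  · rintro ⟨i, j, s⟩
    by_cases hij : i = j
    · subst hij
      simp [ddGen, ddDen, hBdiag, b]
    · have hineq := div_min_add_div_min_le hz hz1 hs i j
      simp only [ddGen, ddDen, if_neg hij]
      rw [quadForm_single_add_smul_single, hBt i j, hBdiag, hBdiag]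
      simp only [B, of_apply, if_neg hij, b, add_dotProduct, smul_dotProduct,
        single_one_dotProduct, smul_eq_mul]
      cases s
      · simp only [Bool.false_eq_true, if_false, neg_one_mul, ← sub_eq_add_neg]
        split_ifs <;> linarith
      · simp only [if_true, one_mul]
        split_ifs <;> linarith

/-- Strong duality with primal attainment at a point `(z, β)` that satisfies the support
condition. -/
theorem exists_optimal_pair {Q : Matrix (Fin p) (Fin p) ℝ} (hQ : Q.PosSemidef) {z β : Fin p → ℝ}
    (hz : ∀ i, 0 ≤ z i) (hz1 : ∀ i, z i ≤ 1) (hs : ∀ i, z i = 0 → β i = 0) :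
    ∃ B L R : Matrix (Fin p) (Fin p) ℝ, (B - vecMulVec β β).PosSemidef ∧
      (∀ q, (ddGen q ⬝ᵥ β) ^ 2 / ddDen z q ≤ ddGen q ⬝ᵥ B *ᵥ ddGen q) ∧
      IsDDDecomp Q L R ∧ frobInner Q B ≤ ddFormReal L R z β := by
  set e : Fin p × Fin p × Bool → ℝ := fun q =>
    (ddGen q ⬝ᵥ β) ^ 2 / ddDen z q - (ddGen q ⬝ᵥ β) ^ 2 with he
  -- the substitution `S = B - β βᵀ` turns the conic problem into a covering program
  obtain ⟨S, hS, hSe, hSmin⟩ := exists_covering_minimizer hQ ddGen ddGen_ne_zero e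
  obtain ⟨l, hl, hle, hR⟩ := exists_covering_multiplier hQ ddGen ddGen_ne_zero e _ hSmin
  set L := ∑ q, l q • vecMulVec (ddGen q) (ddGen q) with hLdef
  have hdec : IsDDDecomp Q L (Q - L) := isDDDecomp_sum_ddGen hl hR
  obtain ⟨B, hB, hBq⟩ := exists_tight_matrix
    (hdec.transpose_eq (transpose_eq_of_posSemidef hQ)) (Q - L) hz hz1 hs
  refine ⟨S + vecMulVec β β, L, Q - L, by simpa using hS, fun q => ?_, hdec, ?_⟩
  · rw [add_mulVec, dotProduct_add, dotProduct_vecMulVec_mulVec]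
    linarith [hSe q]
  · have h1 : ∑ q, l q * e q ≤ frobInner L B - frobInner L (vecMulVec β β) := by
      rw [hLdef, frobInner_sum_ddGen, frobInner_sum_ddGen, ← Finset.sum_sub_distrib]
      refine Finset.sum_le_sum fun q _ => ?_
      rw [← mul_sub, dotProduct_vecMulVec_mulVec]
      exact mul_le_mul_of_nonneg_left (sub_le_sub_right (hBq q) _) (hl q)
    rw [hB, frobInner_add_right, frobInner_vecMulVec, sub_mulVec, dotProduct_sub]
    rw [frobInner_vecMulVec] at h1
    linarith

/-! ### Elimination of the lifted variables -/

theorem posSemidef_gram (X : Matrix (Fin n) (Fin p) ℝ) {lam : ℝ} (hlam : 0 ≤ lam) :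
    (gram X lam).PosSemidef := by
  have := posSemidef_conjTranspose_mul_self X
  rw [conjTranspose_eq_transpose_of_trivial] at this
  exact this.add (PosSemidef.one.smul hlam)

theorem div_le_of_extDiv_add_le {s d m r : ℝ} (hs : 0 ≤ s) (hd : 0 ≤ d) (hdm : d ≤ m)
    (h : extDiv s d + (r : EReal) ≤ 0) : s / m ≤ -r := by
  unfold extDiv at h
  split_ifs at h with h1 h2
  · rw [zero_add] at h
    have : r ≤ 0 := by exact_mod_cast h
    simpa [h2] using this
  · simp at h
  · have h' : s / d + r ≤ 0 := by exact_mod_cast h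
    have := div_le_div_of_nonneg_left hs (hd.lt_of_ne' h1) hdm
    linarith

theorem IsSdpFeasible.eq_zero_of_eq_zero {k : ℕ} {β z u : Fin p → ℝ}
    {w B : Matrix (Fin p) (Fin p) ℝ} (h : IsSdpFeasible k β z u w B) (i : Fin p)
    (hi : z i = 0) : β i = 0 := by
  have := h.persp i
  rw [hi, zero_mul] at this
  exact pow_eq_zero_iff two_ne_zero |>.1 (le_antisymm this (sq_nonneg _))

theorem ddObjective_le_sdpObjective (X : Matrix (Fin n) (Fin p) ℝ) (y : Fin n → ℝ) {lam : ℝ}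
    (mu : ℝ) (hlam : 0 ≤ lam) {k : ℕ} {β z u : Fin p → ℝ} {w B : Matrix (Fin p) (Fin p) ℝ}
    (h : IsSdpFeasible k β z u w B) :
    ddObjective X y lam mu β z u ≤ (sdpObjective X y lam mu β u B : EReal) := by
  rw [sdpObjective, EReal.coe_add, ddObjective]
  gcongr
  refine iSup_le fun L => iSup_le fun R => iSup_le fun hdec => ?_
  rw [ddForm_eq_coe L R h.base.z_nonneg h.eq_zero_of_eq_zero, EReal.coe_le_coe_iff]
  refine ddFormReal_le_frobInner (transpose_eq_of_posSemidef (posSemidef_gram X hlam)) hdec h.psd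
    (fun i => ?_) (fun i j hij => ?_) (fun i j hij => ?_)
  · rcases (h.base.z_nonneg i).eq_or_lt with hi | hi
    · have h1 := h.psd.diag_nonneg (i := i)
      have h2 := h.eq_zero_of_eq_zero i hi.symm
      simp only [Matrix.sub_apply, vecMulVec_apply, h2, mul_zero, sub_zero] at h1
      simpa [h2] using h1
    · rw [div_le_iff₀ hi, mul_comm]
      exact h.persp i
  · have := div_le_of_extDiv_add_le (sq_nonneg _) (h.w_nonneg i j hij)
      (le_min (h.w_le_one i j hij) (h.w_le_add i j hij)) (h.pair_add i j hij)
    linarith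
  · have := div_le_of_extDiv_add_le (sq_nonneg _) (h.w_nonneg i j hij)
      (le_min (h.w_le_one i j hij) (h.w_le_add i j hij)) (h.pair_sub i j hij)
    linarith

/-- On the support, the conic problem attains the objective of the relaxation. -/
theorem exists_sdp_completion (X : Matrix (Fin n) (Fin p) ℝ) (y : Fin n → ℝ) {lam : ℝ}
    (mu : ℝ) (hlam : 0 ≤ lam) {k : ℕ} {β z u : Fin p → ℝ} (h : IsBaseFeasible k β z u)
    (hs : ∀ i, z i = 0 → β i = 0) :
    ∃ w B : Matrix (Fin p) (Fin p) ℝ, IsSdpFeasible k β z u w B ∧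
      ddObjective X y lam mu β z u = (sdpObjective X y lam mu β u B : EReal) := by
  obtain ⟨B, L, R, hB, hBq, hdec, hle⟩ :=
    exists_optimal_pair (posSemidef_gram X hlam) h.z_nonneg h.z_le_one hs
  have hBs : ∀ i j, B j i = B i j := fun i j => by
    have := congrFun (congrFun (transpose_eq_of_posSemidef hB) i) j
    simp only [transpose_apply, Matrix.sub_apply, vecMulVec_apply] at this
    linarith [mul_comm (β i) (β j)]
  have hpair : ∀ i j, i ≠ j → ∀ s : Bool, (β i + (if s then 1 else -1) * β j) ^ 2 /
      min 1 (z i + z j) ≤ B i i + B j j + 2 * ((if s then 1 else -1) * B i j) := by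
    intro i j hij s
    have := hBq (i, j, s)
    simp only [ddGen, ddDen, if_neg hij] at this
    rw [quadForm_single_add_smul_single, hBs i j] at this
    simp only [add_dotProduct, smul_dotProduct, single_one_dotProduct, smul_eq_mul] at this
    refine this.trans_eq ?_
    cases s <;> simp <;> ring
  have hden : ∀ (i j : Fin p) (s : ℝ), min 1 (z i + z j) = 0 → (β i + s * β j) ^ 2 = 0 := by
    intro i j s h0
    obtain ⟨hi, hj⟩ := eq_zero_of_min_add_eq_zero h.z_nonneg h0
    simp [hs i hi, hs j hj]
  have hfeas : IsSdpFeasible k β z u (of fun i j => min 1 (z i + z j)) B := by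
    refine ⟨h, fun i => ?_, fun i j _ => ?_, fun i j _ => min_le_left _ _,
      fun i j _ => min_le_right _ _, fun i j hij => ?_, fun i j hij => ?_, hB⟩
    · rcases (h.z_nonneg i).eq_or_lt with hi | hi
      · simp [← hi, hs i hi.symm]
      · have := hBq (i, i, true)
        simp only [ddGen, ddDen, if_true, single_one_dotProduct, mulVec_single_one,
          col_apply] at this
        rwa [div_le_iff₀ hi, mul_comm] at this
    · exact le_min zero_le_one (add_nonneg (h.z_nonneg i) (h.z_nonneg j))
    · have h1 := hpair i j hij true
      have h2 := hden i j 1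
      simp only [if_true, one_mul] at h1 h2
      rw [of_apply, extDiv_eq_coe h2, ← EReal.coe_add]
      exact_mod_cast (by linarith :
        (β i + β j) ^ 2 / min 1 (z i + z j) + (-2 * B i j - B i i - B j j) ≤ 0)
    · have h1 := hpair i j hij false
      have h2 := hden i j (-1)
      simp only [Bool.false_eq_true, if_false, neg_one_mul, ← sub_eq_add_neg] at h1 h2
      rw [of_apply, extDiv_eq_coe h2, ← EReal.coe_add]
      exact_mod_cast (by linarith :
        (β i - β j) ^ 2 / min 1 (z i + z j) + (2 * B i j - B i i - B j j) ≤ 0)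
  refine ⟨_, B, hfeas, (ddObjective_le_sdpObjective X y mu hlam hfeas).antisymm ?_⟩
  rw [ddObjective, sdpObjective, EReal.coe_add]
  gcongr
  refine le_trans ?_ (le_iSup_of_le L (le_iSup_of_le R (le_iSup_of_le hdec le_rfl)))
  rw [ddForm_eq_coe L R h.z_nonneg hs]
  exact_mod_cast hle

/-! ### Points off the support -/

theorem coe_mul_sum {ι : Type*} {c : ℝ} (hc : 0 ≤ c) (s : Finset ι) (f : ι → EReal) :
    (c : EReal) * ∑ i ∈ s, f i = ∑ i ∈ s, (c : EReal) * f i := by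
  classical
  induction s using Finset.induction_on with
  | empty => simp
  | insert a s ha ih =>
    rw [Finset.sum_insert ha, Finset.sum_insert ha,
      EReal.left_distrib_of_nonneg_of_ne_top (by exact_mod_cast hc) (EReal.coe_ne_top c), ih]

theorem extDiv_le_mul_extDiv {s d d' t : ℝ} (hs : 0 ≤ s) (ht : 0 < t) (hd : 0 ≤ d) (hd' : 0 < d')
    (h : d ≤ t * d') : extDiv s d' ≤ (t : EReal) * extDiv s d := by
  rw [extDiv_eq_coe fun h => absurd h hd'.ne']
  unfold extDiv
  split_ifs with h1 h2
  · simp [h2]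
  · rw [EReal.coe_mul_top_of_pos ht]
    exact le_top
  · rw [← EReal.coe_mul, EReal.coe_le_coe_iff, div_le_iff₀ hd', mul_assoc, div_mul_eq_mul_div,
      mul_div_assoc', le_div_iff₀ (hd.lt_of_ne' h1)]
    nlinarith

theorem ddForm_le_mul_ddForm {Q L R : Matrix (Fin p) (Fin p) ℝ} (hQ : Qᵀ = Q)
    (h : IsDDDecomp Q L R) {z z' : Fin p → ℝ} (β : Fin p → ℝ) {t : ℝ} (ht : 1 ≤ t)
    (hz : ∀ i, 0 ≤ z i) (hz' : ∀ i, 0 < z' i) (hzz' : ∀ i, z i ≤ t * z' i) :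
    ddForm L R z' β ≤ (t : EReal) * ddForm L R z β := by
  have ht0 : 0 < t := one_pos.trans_le ht
  have hL := h.transpose_eq hQ
  unfold ddForm
  have hdist := EReal.left_distrib_of_nonneg_of_ne_top (x := (t : EReal))
    (by exact_mod_cast ht0.le) (EReal.coe_ne_top t)
  rw [hdist, hdist, coe_mul_sum ht0.le, coe_mul_sum ht0.le]
  refine add_le_add (add_le_add ?_ (Finset.sum_le_sum fun i _ => ?_))
    (Finset.sum_le_sum fun i _ => ?_)
  · rw [← EReal.coe_mul, EReal.coe_le_coe_iff]
    exact le_mul_of_one_le_left (quadForm_nonneg h.psd β) ht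
  · rw [mul_left_comm]
    refine mul_le_mul_of_nonneg_left
      (extDiv_le_mul_extDiv (sq_nonneg _) ht0 (hz i) (hz' i) (hzz' i)) ?_
    exact_mod_cast sub_nonneg.2 ((sum_erase_abs_le_iff hL i).1 (h.dominant i))
  · rw [coe_mul_sum ht0.le]
    refine Finset.sum_le_sum fun j _ => ?_
    rw [mul_left_comm]
    refine mul_le_mul_of_nonneg_left (extDiv_le_mul_extDiv (sq_nonneg _) ht0
      (le_min zero_le_one (add_nonneg (hz i) (hz j)))
      (lt_min one_pos (add_pos (hz' i) (hz' j))) ?_) (by exact_mod_cast abs_nonneg _)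
    rw [mul_min_of_nonneg _ _ ht0.le, mul_one]
    exact min_le_min ht (by linarith [hzz' i, hzz' j])

theorem sdpValue_le_ddObjective_of_support (X : Matrix (Fin n) (Fin p) ℝ) (y : Fin n → ℝ)
    {lam : ℝ} (mu : ℝ) (hlam : 0 ≤ lam) {k : ℕ} {β z u : Fin p → ℝ}
    (h : IsBaseFeasible k β z u) (hs : ∀ i, z i = 0 → β i = 0) :
    sdpValue X y lam mu k ≤ ddObjective X y lam mu β z u := by
  obtain ⟨w, B, hfeas, heq⟩ := exists_sdp_completion X y mu hlam h hs
  rw [heq]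
  exact iInf_le_of_le β <| iInf_le_of_le z <| iInf_le_of_le u <| iInf_le_of_le w <|
    iInf_le_of_le B <| iInf_le_of_le hfeas le_rfl

theorem ddPhi_nonneg {Q : Matrix (Fin p) (Fin p) ℝ} (hQ : Q.PosSemidef) (z β : Fin p → ℝ) :
    0 ≤ ddPhi Q z β := by
  have hdec : IsDDDecomp Q 0 Q := ⟨zero_add Q, fun i => by simp, hQ⟩
  refine le_trans ?_ (le_iSup_of_le 0 (le_iSup_of_le Q (le_iSup_of_le hdec le_rfl)))
  simpa [ddForm] using quadForm_nonneg hQ β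

/-- If `k ≥ 1`, mixing `z` with a constant vector gives feasible points of full support, at which
a finite objective of the relaxation is exceeded by at most an arbitrarily small amount. -/
theorem sdpValue_le_ddObjective_of_one_le (X : Matrix (Fin n) (Fin p) ℝ) (y : Fin n → ℝ)
    {lam : ℝ} (mu : ℝ) (hlam : 0 ≤ lam) {k : ℕ} (hk : 1 ≤ k) {β z u : Fin p → ℝ}
    (h : IsBaseFeasible k β z u) :
    sdpValue X y lam mu k ≤ ddObjective X y lam mu β z u := by
  have hQ := posSemidef_gram X hlam
  set c : ℝ := y ⬝ᵥ y - 2 * (y ⬝ᵥ X *ᵥ β) + mu * ∑ i, u i with hc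
  have key : ∀ t : ℝ, 1 < t →
      sdpValue X y lam mu k ≤ (c : EReal) + (t : EReal) * ddPhi (gram X lam) z β := by
    intro t ht
    have ht0 : 0 < t := one_pos.trans ht
    have htinv : t⁻¹ < 1 := inv_lt_one_of_one_lt₀ ht
    have htinv0 : 0 < t⁻¹ := inv_pos.2 ht0
    set z' : Fin p → ℝ := fun i => t⁻¹ * z i + (1 - t⁻¹) / p with hz'
    have hp : ∀ _ : Fin p, (1 : ℝ) ≤ p := fun i => by
      exact_mod_cast Nat.one_le_iff_ne_zero.2 (Fin.pos i).ne'
    have hpos : ∀ i, 0 < (1 - t⁻¹) / p := fun i =>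
      div_pos (sub_pos.2 htinv) (one_pos.trans_le (hp i))
    have hz'pos : ∀ i, 0 < z' i := fun i =>
      add_pos_of_nonneg_of_pos (mul_nonneg htinv0.le (h.z_nonneg i)) (hpos i)
    have hzz' : ∀ i, z i ≤ t * z' i := fun i => by
      rw [hz']
      simp only [mul_add]
      rw [mul_inv_cancel_left₀ ht0.ne']
      exact le_add_of_nonneg_right (mul_nonneg ht0.le (hpos i).le)
    have hbase : IsBaseFeasible k β z' u := by
      refine ⟨?_, h.le_u, h.neg_le_u, fun i => (hz'pos i).le, fun i => ?_, h.u_nonneg⟩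
      · have h1 : (p : ℝ) * ((1 - t⁻¹) / p) ≤ 1 - t⁻¹ := by
          rw [mul_div_left_comm]
          exact mul_le_of_le_one_right (sub_pos.2 htinv).le (div_self_le_one _)
        have hk' : (1 : ℝ) ≤ k := by exact_mod_cast hk
        have h2 := mul_le_mul_of_nonneg_left h.card htinv0.le
        simp only [hz', Finset.sum_add_distrib, ← Finset.mul_sum, Finset.sum_const,
          Finset.card_univ, Fintype.card_fin, nsmul_eq_mul]
        nlinarith
      · have h1 : (1 - t⁻¹) / p ≤ 1 - t⁻¹ := div_le_self (sub_pos.2 htinv).le (hp i)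
        have h2 := mul_le_mul_of_nonneg_left (h.z_le_one i) htinv0.le
        simp only [hz']
        linarith
    refine (sdpValue_le_ddObjective_of_support X y mu hlam hbase
      fun i hi => absurd hi (hz'pos i).ne').trans ?_
    rw [ddObjective, ← hc]
    gcongr
    refine iSup_le fun L => iSup_le fun R => iSup_le fun hdec => ?_
    refine (ddForm_le_mul_ddForm (transpose_eq_of_posSemidef hQ) hdec β ht.le h.z_nonneg hz'pos
      hzz').trans ?_
    exact mul_le_mul_of_nonneg_left
      (le_iSup_of_le L (le_iSup_of_le R (le_iSup_of_le hdec le_rfl))) (by exact_mod_cast ht0.le)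
  rw [ddObjective, ← hc]
  have h0 := ddPhi_nonneg hQ z β
  generalize ddPhi (gram X lam) z β = φ at key h0
  induction φ using EReal.rec with
  | bot => simp at h0
  | top => simp
  | coe φ =>
    have hlim : Filter.Tendsto (fun t : ℝ => ((c + t * φ : ℝ) : EReal)) (nhdsWithin 1 (Set.Ioi 1))
        (nhds ((c + 1 * φ : ℝ) : EReal)) := by
      refine (Continuous.tendsto ?_ 1).mono_left nhdsWithin_le_nhds
      exact continuous_coe_real_ereal.comp (by fun_prop)
    rw [one_mul, EReal.coe_add] at hlim
    refine ge_of_tendsto hlim ?_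
    filter_upwards [self_mem_nhdsWithin] with t ht
    simpa using key t ht

/-- If `Q` is positive definite, some positive multiple of the identity can serve as the
diagonally dominant part, and it makes the objective infinite off the support. -/
theorem ddPhi_eq_top {Q : Matrix (Fin p) (Fin p) ℝ} (hQ : Q.PosDef) {z β : Fin p → ℝ}
    (hz : ∀ i, 0 ≤ z i) {i : Fin p} (hzi : z i = 0) (hβi : β i ≠ 0) : ddPhi Q z β = ⊤ := by
  obtain ⟨P, c, hc, -, -, hPQ, hQP⟩ := exists_range_projection hQ.posSemidef
  obtain rfl : P = 1 := hQ.isUnit.mul_right_cancel (by rw [hPQ, one_mul])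
  have hzero : ∀ i, ∑ j ∈ Finset.univ.erase i, |(c • (1 : Matrix (Fin p) (Fin p) ℝ)) i j| = 0 :=
    fun i => Finset.sum_eq_zero fun j hj => by simp [(Finset.ne_of_mem_erase hj).symm]
  have hdec : IsDDDecomp Q (c • 1) (Q - c • 1) := by
    refine ⟨by abel, fun i => ?_, hQP⟩
    rw [sum_erase_abs_le_iff (by simp), hzero]
    simpa using hc.le
  refine top_le_iff.1 (le_trans ?_ (le_iSup_of_le _ (le_iSup_of_le _ (le_iSup_of_le hdec le_rfl))))
  have hdiag : ∀ i, ((((c • (1 : Matrix (Fin p) (Fin p) ℝ)) i i) -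
      ∑ j ∈ Finset.univ.erase i, |(c • (1 : Matrix (Fin p) (Fin p) ℝ)) i j| : ℝ) : EReal) = c :=
    fun i => by rw [hzero]; simp
  simp only [ddForm, hdiag]
  have h1 : ∑ i, (c : EReal) * extDiv (β i ^ 2) (z i) = ⊤ := by
    refine top_le_iff.1 (le_trans ?_ (Finset.single_le_sum (fun j _ => mul_nonneg
      (by exact_mod_cast hc.le) (extDiv_nonneg (sq_nonneg _) (hz j))) (Finset.mem_univ i)))
    simp [extDiv, hzi, hβi, EReal.coe_mul_top_of_pos hc]
  rw [h1, EReal.coe_add_top, EReal.top_add_of_ne_bot]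
  refine (EReal.bot_lt_zero.trans_le (Finset.sum_nonneg fun i _ => Finset.sum_nonneg fun j _ =>
    mul_nonneg (by exact_mod_cast abs_nonneg _) (extDiv_nonneg (sq_nonneg _) ?_))).ne'
  exact le_min zero_le_one (add_nonneg (hz i) (hz j))

theorem sdpValue_le_ddObjective (X : Matrix (Fin n) (Fin p) ℝ) (y : Fin n → ℝ)
    {lam : ℝ} (mu : ℝ) (hlam : 0 ≤ lam) {k : ℕ} (hk : 1 ≤ k ∨ (gram X lam).PosDef)
    {β z u : Fin p → ℝ} (h : IsBaseFeasible k β z u) :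
    sdpValue X y lam mu k ≤ ddObjective X y lam mu β z u := by
  rcases hk with hk | hQ
  · exact sdpValue_le_ddObjective_of_one_le X y mu hlam hk h
  · by_cases hs : ∀ i, z i = 0 → β i = 0
    · exact sdpValue_le_ddObjective_of_support X y mu hlam h hs
    · push Not at hs
      obtain ⟨i, hzi, hβi⟩ := hs
      rw [ddObjective, ddPhi_eq_top hQ h.z_nonneg hzi hβi, EReal.coe_add_top]
      exact le_top

end SparseRegression

theorem proposition6 (n p : ℕ) (X : Matrix (Fin n) (Fin p) ℝ) (y : Fin n → ℝ)
    (lam mu : ℝ) (hlam : 0 ≤ lam) (hmu : 0 ≤ mu) (k : ℕ) :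
    -- eliminating `(w, B)` from `SDP_dd` gives the objective of the relaxation, as a minimum
    (∀ β z u : Fin p → ℝ, SparseRegression.IsBaseFeasible k β z u →
      (∀ i, z i = 0 → β i = 0) →
      IsLeast
        {v : EReal | ∃ w B : Matrix (Fin p) (Fin p) ℝ,
          SparseRegression.IsSdpFeasible k β z u w B ∧
            v = ((SparseRegression.sdpObjective X y lam mu β u B : ℝ) : EReal)}
        (SparseRegression.ddObjective X y lam mu β z u)) ∧
    -- the two problems have the same optimal value and corresponding optimal solutions
    ((1 ≤ k ∨ (SparseRegression.gram X lam).PosDef) →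
      SparseRegression.ddValue X y lam mu k = SparseRegression.sdpValue X y lam mu k ∧
      ∀ β z u : Fin p → ℝ,
        (∃ w B : Matrix (Fin p) (Fin p) ℝ,
          SparseRegression.IsSdpOptimal X y lam mu k β z u w B) ↔
        (SparseRegression.IsDDOptimal X y lam mu k β z u ∧ ∀ i, z i = 0 → β i = 0)) := by
  open SparseRegression in
  refine ⟨fun β z u h hs => ⟨exists_sdp_completion X y mu hlam h hs, ?_⟩, fun hk => ⟨?_, ?_⟩⟩
  · rintro _ ⟨w, B, hfeas, rfl⟩
    exact ddObjective_le_sdpObjective X y mu hlam hfeas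
  · refine le_antisymm ?_ ?_
    · refine le_iInf fun β => le_iInf fun z => le_iInf fun u => le_iInf fun w => le_iInf fun B =>
        le_iInf fun hfeas => ?_
      exact iInf_le_of_le β <| iInf_le_of_le z <| iInf_le_of_le u <| iInf_le_of_le hfeas.base <|
        ddObjective_le_sdpObjective X y mu hlam hfeas
    · exact le_iInf fun β => le_iInf fun z => le_iInf fun u => le_iInf fun h =>
        sdpValue_le_ddObjective X y mu hlam hk h
  · intro β z u
    constructor
    · rintro ⟨w, B, hfeas, hopt⟩
      refine ⟨⟨hfeas.base, fun β' z' u' h' => ?_⟩, hfeas.eq_zero_of_eq_zero⟩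
      refine le_trans ?_ (sdpValue_le_ddObjective X y mu hlam hk h')
      refine (ddObjective_le_sdpObjective X y mu hlam hfeas).trans ?_
      refine le_iInf fun β => le_iInf fun z => le_iInf fun u => le_iInf fun w => le_iInf fun B =>
        le_iInf fun h => ?_
      exact_mod_cast hopt β z u w B h
    · rintro ⟨⟨h, hopt⟩, hs⟩
      obtain ⟨w, B, hfeas, heq⟩ := exists_sdp_completion X y mu hlam h hs
      refine ⟨w, B, hfeas, fun β' z' u' w' B' h' => ?_⟩
      have := (hopt β' z' u' h'.base).trans (ddObjective_le_sdpObjective X y mu hlam h')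
      rw [heq] at this
      exact_mod_cast this
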